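/- Let $d \ge k$ and $\alpha > 1$, and let $v, w \in \mathbb{R}^{d\times k}$ be arbitrary deterministic matrices. Let $V = v + N$ and $W = w + N$, where $N \in \mathbb{R}^{d\times k}$ has i.i.d. $\mathcal{N}(0,1)$ entries, and for each number $n_{\mathrm{syn}} \in \mathbb{N}$ of synthetic records let $Z \in \mathbb{R}^{n_{\mathrm{syn}}\times d}$ be a matrix with i.i.d. $\mathcal{N}(0,1)$ entries, independent of $N$. For random variables $X \sim P$ and $Y \sim Q$ write $D_\alpha(X,Y) = D_\alpha(P,Q) = \frac{1}{\alpha-1}\log \mathbb{E}_{x\sim Q}\big[\big(\tfrac{dP}{dQ}(x)\big)^\alpha\big] \in [0,+\infty]$ for the Rényi divergence of order $\alpha$ of their laws (equal to $+\infty$ if $P \not\ll Q$). Then \[ D_\alpha(V^\top Z^\top Z V,\, W^\top Z^\top Z W) \longrightarrow D_\alpha(V^\top V,\, W^\top W) \qquad (n_{\mathrm{syn}} \to \infty), \] and, for every $n_{\mathrm{syn}}$, \[ D_\alpha(ZV, ZW) \le D_\alpha(V^\top V, W^\top W). \] Moreover, releasing arbitrarily many synthetic records is equivalent, privacy-wise,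 to releasing the Gram matrix, in the sense that also \[ D_\alpha(ZV, ZW) \longrightarrow D_\alpha(V^\top V, W^\top W) \qquad (n_{\mathrm{syn}} \to \infty). \] -/

import Mathlib

open MeasureTheory ProbabilityTheory Filter Topology
open scoped ENNReal Matrix

noncomputable section

namespace GramRelease

/-- The product (equivalently, Borel) `σ`-algebra on real `m × n` matrices. -/
instance matrixMeasurableSpace (m n : ℕ) : MeasurableSpace (Matrix (Fin m) (Fin n) ℝ) :=
  inferInstanceAs (MeasurableSpace (Fin m → Fin n → ℝ))

/-- The Rényi divergence of order `α > 1`,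
`D_α(P, Q) = (α - 1)⁻¹ log 𝔼_{x ∼ Q} [(dP/dQ (x)) ^ α]`, with values in the extended reals;
it is `+∞` when `P` is not absolutely continuous with respect to `Q`. -/
def renyiDiv {X : Type*} [MeasurableSpace X] (α : ℝ) (P Q : Measure X) : EReal :=
  open Classical in
  if P ≪ Q then (((α - 1)⁻¹ : ℝ) : EReal) * ENNReal.log (∫⁻ x, (P.rnDeriv Q x) ^ α ∂Q) else ⊤

/-- The law of a random `m × n` matrix with i.i.d. standard normal entries. -/
def gaussianMatrix (m n : ℕ) : Measure (Matrix (Fin m) (Fin n) ℝ) :=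
  Measure.pi (fun _ : Fin m => Measure.pi (fun _ : Fin n => gaussianReal 0 1))

/-- The law of the privatized parameter `V = v + N`, where `N` is a standard Gaussian matrix. -/
def paramLaw {d k : ℕ} (v : Matrix (Fin d) (Fin k) ℝ) : Measure (Matrix (Fin d) (Fin k) ℝ) :=
  (gaussianMatrix d k).map (fun N => v + N)

/-- The law of the synthetic data set `Z V`, where `Z` is an `n × d` standard Gaussian matrix
that is independent of `V = v + N`. -/
def synthLaw (n : ℕ) {d k : ℕ} (v : Matrix (Fin d) (Fin k) ℝ) :
    Measure (Matrix (Fin n) (Fin k) ℝ) :=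
  ((gaussianMatrix n d).prod (paramLaw v)).map (fun p => p.1 * p.2)

/-- The law of `Vᵀ Zᵀ Z V`, with `Z` and `V` as in `synthLaw`. -/
def synthGramLaw (n : ℕ) {d k : ℕ} (v : Matrix (Fin d) (Fin k) ℝ) :
    Measure (Matrix (Fin k) (Fin k) ℝ) :=
  ((gaussianMatrix n d).prod (paramLaw v)).map (fun p => p.2ᵀ * p.1ᵀ * p.1 * p.2)

/-- The law of the Gram matrix `Vᵀ V`, where `V = v + N`. -/
def gramLaw {d k : ℕ} (v : Matrix (Fin d) (Fin k) ℝ) : Measure (Matrix (Fin k) (Fin k) ℝ) :=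
  (paramLaw v).map (fun V => Vᵀ * V)

end GramRelease

end

/-! Two data-processing inequalities bound the synthetic moments from above, and lower
semicontinuity bounds them from below. By rotation invariance, the law of `Z * V` for fixed `V`
depends only on `Vᵀ * V`, so `ZV` can be sampled from the Gram matrix as `Z' * psdSqrt (Vᵀ * V)`
with fresh Gaussian noise (`synthLaw_eq_map_gramLaw`). Conversely `VᵀZᵀZV` is a function of `ZV`.
Hence moment of `VᵀZᵀZV` ≤ moment of `ZV` ≤ moment of `VᵀV`, for every `n`.

By the strong law `ZᵀZ / n → 1` almost surely, so the rescaled synthetic Gram matrix converges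
weakly to `VᵀV`. Rényi moments are weakly lower semicontinuous (`eventually_lt_renyiMoment`), and
rescaling cannot increase them, so the outer terms of the chain have the same limit and both
convergences follow.

The tool for moments is duality: for finite `C`, the moment is at most `C` exactly when
`HolderBound` holds with `C`. This form passes easily through maps, products and limits. -/

namespace GramRelease

/-! ### Rényi moments by Hölder duality: data processing and lower semicontinuity -/

section Renyi

variable {X Y : Type*} [MeasurableSpace X] [MeasurableSpace Y] {α β : ℝ}

/-- The moment `𝔼_{x ∼ Q} [(dP/dQ (x)) ^ α]`, set to `∞` when `P` is not absolutely continuous with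
respect to `Q`. -/
noncomputable def renyiMoment (α : ℝ) (P Q : Measure X) : ℝ≥0∞ :=
  open Classical in if P ≪ Q then ∫⁻ x, (P.rnDeriv Q x) ^ α ∂Q else ⊤

/-- Since `(α - 1)⁻¹ > 0`, an infinite moment gives `⊤`, which absorbs the convention for the
singular case. -/
theorem renyiDiv_eq_log_renyiMoment (hα : 1 < α) (P Q : Measure X) :
    renyiDiv α P Q = (((α - 1)⁻¹ : ℝ) : EReal) * ENNReal.log (renyiMoment α P Q) := by
  unfold renyiDiv renyiMoment
  split_ifs with h
  · rfl
  · rw [ENNReal.log_top, EReal.coe_mul_top_of_pos (inv_pos.2 (sub_pos.2 hα))]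

/-- The inequality `∫ g dP ≤ C ^ (1 / α) * ‖g‖_{L^β(Q)}` for all nonnegative measurable `g`. -/
def HolderBound (α β : ℝ) (P Q : Measure X) (C : ℝ≥0∞) : Prop :=
  ∀ g : X → ℝ≥0∞, Measurable g →
    ∫⁻ x, g x ∂P ≤ C ^ (1 / α) * (∫⁻ x, g x ^ β ∂Q) ^ (1 / β)

/-- Hölder's inequality for the pair `dP/dQ`, `g`. -/
theorem holderBound_renyiMoment (hαβ : α.HolderConjugate β) {P Q : Measure X}
    [IsFiniteMeasure P] [IsFiniteMeasure Q] (h : renyiMoment α P Q ≠ ⊤) :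
    HolderBound α β P Q (renyiMoment α P Q) := by
  have hPQ : P ≪ Q := by
    by_contra hPQ
    simp [renyiMoment, hPQ] at h
  intro g hg
  rw [renyiMoment, if_pos hPQ]
  conv_lhs => rw [← Measure.withDensity_rnDeriv_eq P Q hPQ]
  rw [lintegral_withDensity_eq_lintegral_mul _ (Measure.measurable_rnDeriv P Q) hg]
  exact ENNReal.lintegral_mul_le_Lp_mul_Lq Q hαβ (Measure.measurable_rnDeriv P Q).aemeasurable
    hg.aemeasurable

theorem HolderBound.absolutelyContinuous (hβ : 0 < β) {P Q : Measure X} {C : ℝ≥0∞}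
    (h : HolderBound α β P Q C) : P ≪ Q := by
  refine Measure.AbsolutelyContinuous.mk fun s hs hQ => ?_
  have h1 := h (s.indicator 1) (measurable_one.indicator hs)
  have h2 : (fun x => (s.indicator (1 : X → ℝ≥0∞) x) ^ β) = s.indicator 1 := by
    ext x
    by_cases hx : x ∈ s <;> simp [hx, hβ]
  rw [h2, lintegral_indicator_one hs, lintegral_indicator_one hs, hQ,
    ENNReal.zero_rpow_of_pos (by positivity), mul_zero] at h1
  exact le_antisymm h1 zero_le

theorem tendsto_min_natCast (a : ℝ≥0∞) : Tendsto (fun m : ℕ => min a (m : ℝ≥0∞)) atTop (𝓝 a) := by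
  simpa using (tendsto_const_nhds (x := a)).min ENNReal.tendsto_nat_nhds_top

theorem monotone_min_natCast (a : ℝ≥0∞) : Monotone (fun m : ℕ => min a (m : ℝ≥0∞)) :=
  fun _ _ h => min_le_min le_rfl (by exact_mod_cast h)

/-- Converse half of the duality: test against the Hölder extremizer `f ^ (α - 1)`, with `f = dP/dQ`
truncated at `m` so that the moment is finite and can be cancelled, then let `m → ∞`. -/
theorem HolderBound.renyiMoment_le (hαβ : α.HolderConjugate β) {P Q : Measure X}
    [IsFiniteMeasure P] [IsFiniteMeasure Q] {C : ℝ≥0∞} (h : HolderBound α β P Q C) :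
    renyiMoment α P Q ≤ C := by
  have hPQ := h.absolutelyContinuous hαβ.symm.pos
  rw [renyiMoment, if_pos hPQ]
  set f := P.rnDeriv Q
  have hf : Measurable f := Measure.measurable_rnDeriv P Q
  have hlim : Tendsto (fun m : ℕ => ∫⁻ x, (min (f x) m) ^ α ∂Q) atTop (𝓝 (∫⁻ x, f x ^ α ∂Q)) := by
    refine lintegral_tendsto_of_tendsto_of_monotone (fun m => by fun_prop)
      (ae_of_all _ fun x m n hmn => ?_) (ae_of_all _ fun x => ?_)
    · exact ENNReal.rpow_le_rpow (monotone_min_natCast _ hmn) hαβ.nonneg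
    · exact ((ENNReal.continuous_rpow_const).tendsto _).comp (tendsto_min_natCast _)
  refine le_of_tendsto' hlim fun m => ?_
  set A := ∫⁻ x, (min (f x) m) ^ α ∂Q with hA
  have hAtop : A ≠ ⊤ := by
    refine ne_top_of_le_ne_top (b := (m : ℝ≥0∞) ^ α * Q Set.univ) ?_ ?_
    · exact ENNReal.mul_ne_top (ENNReal.rpow_ne_top_of_nonneg hαβ.nonneg (by simp))
        (measure_ne_top _ _)
    · rw [← lintegral_const]
      exact lintegral_mono fun x => ENNReal.rpow_le_rpow (min_le_right _ _) hαβ.nonneg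
  have hle : A ≤ C ^ (1 / α) * A ^ (1 / β) := by
    have h1 := h (fun x => (min (f x) m) ^ (α - 1)) (by fun_prop)
    have h2 : ∀ x, ((min (f x) m) ^ (α - 1)) ^ β = (min (f x) m) ^ α := fun x => by
      rw [← ENNReal.rpow_mul, hαβ.sub_one_mul_conj]
    simp only [h2] at h1
    refine le_trans ?_ h1
    conv_rhs => rw [← Measure.withDensity_rnDeriv_eq P Q hPQ]
    rw [lintegral_withDensity_eq_lintegral_mul _ hf (by fun_prop), hA]
    refine lintegral_mono fun x => ?_
    have h3 : (min (f x) m) ^ α = min (f x) m * (min (f x) m) ^ (α - 1) := by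
      conv_rhs => enter [1]; rw [← ENNReal.rpow_one (min (f x) m)]
      rw [← ENNReal.rpow_add_of_nonneg _ _ zero_le_one (sub_nonneg.2 hαβ.lt.le)]
      congr 1
      ring
    simp only [Pi.mul_apply]
    rw [h3]
    exact mul_le_mul' (min_le_left _ _) le_rfl
  rcases eq_or_ne A 0 with h0 | h0
  · simp [h0]
  -- As `A` is neither `0` nor `⊤`, the factor `A ^ (1 / β)` cancels from `hle`.
  · have h4 : A = A ^ (1 / α) * A ^ (1 / β) := by
      rw [← ENNReal.rpow_add _ _ h0 hAtop, one_div, one_div, hαβ.inv_add_inv_eq_one,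
        ENNReal.rpow_one]
    have h5 : A ^ (1 / β) ≠ 0 := by simp [ENNReal.rpow_eq_zero_iff, h0, hAtop]
    have h6 : A ^ (1 / β) ≠ ⊤ := by simp [ENNReal.rpow_eq_top_iff, h0, hAtop]
    have h7 : A ^ (1 / α) ≤ C ^ (1 / α) := by
      rw [← ENNReal.mul_le_mul_iff_left h5 h6, ← h4]
      exact hle
    exact (ENNReal.rpow_le_rpow_iff (by have := hαβ.pos; positivity)).1 h7

theorem HolderBound.map {P Q : Measure X} {C : ℝ≥0∞} (h : HolderBound α β P Q C) {φ : X → Y}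
    (hφ : Measurable φ) : HolderBound α β (P.map φ) (Q.map φ) C := by
  intro g hg
  rw [lintegral_map hg hφ, lintegral_map (by fun_prop) hφ]
  exact h _ (hg.comp hφ)

/-- The bound applies on each fibre; concavity of `t ^ (1 / β)` and total mass one of `μ` then
recombine the fibres. -/
theorem HolderBound.prod_left (hαβ : α.HolderConjugate β) {P Q : Measure X} [SFinite P] [SFinite Q] {C : ℝ≥0∞}
    (h : HolderBound α β P Q C) (μ : Measure Y) [IsProbabilityMeasure μ] :
    HolderBound α β (μ.prod P) (μ.prod Q) C := by
  intro g hg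
  rw [lintegral_prod _ hg.aemeasurable, lintegral_prod _ (by fun_prop)]
  calc ∫⁻ y, ∫⁻ x, g (y, x) ∂P ∂μ
      ≤ ∫⁻ y, C ^ (1 / α) * (∫⁻ x, g (y, x) ^ β ∂Q) ^ (1 / β) ∂μ :=
        lintegral_mono fun y => h _ (by fun_prop)
    _ = C ^ (1 / α) * ∫⁻ y, (∫⁻ x, g (y, x) ^ β ∂Q) ^ (1 / β) ∂μ := by
        rw [lintegral_const_mul]
        exact (Measurable.lintegral_prod_right' (f := fun p : Y × X => g p ^ β)
          (by fun_prop)).pow_const _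
    _ ≤ C ^ (1 / α) * (∫⁻ y, ∫⁻ x, g (y, x) ^ β ∂Q ∂μ) ^ (1 / β) := by
        gcongr
        have hm : Measurable fun y => ∫⁻ x, g (y, x) ^ β ∂Q :=
          Measurable.lintegral_prod_right' (f := fun p : Y × X => g p ^ β) (by fun_prop)
        have hb : ∀ y, ((∫⁻ x, g (y, x) ^ β ∂Q) ^ (1 / β)) ^ β = ∫⁻ x, g (y, x) ^ β ∂Q :=
          fun y => by rw [one_div, ENNReal.rpow_inv_rpow hαβ.symm.ne_zero]
        -- Jensen's inequality, obtained as Hölder against the constant `1`.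
        simpa [-one_div, hb] using ENNReal.lintegral_mul_le_Lp_mul_Lq μ hαβ.symm
          (hm.pow_const (1 / β)).aemeasurable (measurable_const (a := (1 : ℝ≥0∞))).aemeasurable

theorem renyiMoment_map_le (hαβ : α.HolderConjugate β) {P Q : Measure X} [IsFiniteMeasure P]
    [IsFiniteMeasure Q] {φ : X → Y} (hφ : Measurable φ) :
    renyiMoment α (P.map φ) (Q.map φ) ≤ renyiMoment α P Q := by
  by_cases h : renyiMoment α P Q = ⊤
  · simp [h]
  · exact ((holderBound_renyiMoment hαβ h).map hφ).renyiMoment_le hαβ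

theorem renyiMoment_prod_left_le (hαβ : α.HolderConjugate β) {P Q : Measure X} [IsFiniteMeasure P]
    [IsFiniteMeasure Q] (μ : Measure Y) [IsProbabilityMeasure μ] :
    renyiMoment α (μ.prod P) (μ.prod Q) ≤ renyiMoment α P Q := by
  by_cases h : renyiMoment α P Q = ⊤
  · simp [h]
  · exact ((holderBound_renyiMoment hαβ h).prod_left hαβ μ).renyiMoment_le hαβ

/-- A Hölder bound for bounded continuous functions extends to all measurable functions. -/
theorem HolderBound.of_continuous [TopologicalSpace X] [BorelSpace X] [NormalSpace X]
    {P Q : Measure X} [IsProbabilityMeasure P] [IsFiniteMeasure Q] [(P + Q).WeaklyRegular]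
    {C : ℝ≥0∞} (hC : C ≠ ⊤) (hαβ : α.HolderConjugate β)
    (h : ∀ g : X → NNReal, Continuous g → (∃ M, ∀ x, g x ≤ M) →
      ∫⁻ x, g x ∂P ≤ C ^ (1 / α) * (∫⁻ x, (g x : ℝ≥0∞) ^ β ∂Q) ^ (1 / β)) :
    HolderBound α β P Q C := by
  have hβ0 : 0 < β := hαβ.symm.pos
  have hβ1 : 1 ≤ ENNReal.ofReal β := by simpa using hαβ.symm.lt.le
  have hβne : ENNReal.ofReal β ≠ 0 := (zero_lt_one.trans_le hβ1).ne'
  have hCtop : C ^ (1 / α) ≠ ⊤ :=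
    ENNReal.rpow_ne_top_of_nonneg (by have := hαβ.pos; positivity) hC
  have hnorm : ∀ u : X → ℝ, eLpNorm u (ENNReal.ofReal β) Q = (∫⁻ x, ‖u x‖ₑ ^ β ∂Q) ^ (1 / β) :=
    fun u => by
      rw [eLpNorm_eq_lintegral_rpow_enorm_toReal hβne ENNReal.ofReal_ne_top,
        ENNReal.toReal_ofReal hβ0.le]
  have hcont : ∀ u : BoundedContinuousFunction X ℝ,
      eLpNorm u 1 P ≤ C ^ (1 / α) * eLpNorm u (ENNReal.ofReal β) Q := fun u => by
    rw [hnorm, eLpNorm_one_eq_lintegral_enorm]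
    exact h (fun x => ‖u x‖₊) (by fun_prop) ⟨‖u‖₊, fun x => u.norm_coe_le_norm x⟩
  -- Approximation in `L^β(P + Q)` controls the errors under `P` and `Q` at once; as `P` is a
  -- probability measure, its `L^1` error is at most its `L^β` error.
  have hbdd : ∀ u : X → ℝ, MemLp u (ENNReal.ofReal β) (P + Q) →
      eLpNorm u 1 P ≤ C ^ (1 / α) * eLpNorm u (ENNReal.ofReal β) Q := by
    intro u hu
    have key : ∀ ε : ℝ≥0∞, ε ≠ 0 → eLpNorm u 1 P ≤
        ε + C ^ (1 / α) * (eLpNorm u (ENNReal.ofReal β) Q + ε) := by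
      intro ε hε
      obtain ⟨u', hu', hmem, hbound⟩ : ∃ u' : X → ℝ,
          eLpNorm (u - u') (ENNReal.ofReal β) (P + Q) ≤ ε ∧ MemLp u' (ENNReal.ofReal β) (P + Q) ∧
          eLpNorm u' 1 P ≤ C ^ (1 / α) * eLpNorm u' (ENNReal.ofReal β) Q := by
        obtain ⟨f, hf, hfm⟩ := hu.exists_boundedContinuous_eLpNorm_sub_le ENNReal.ofReal_ne_top hε
        exact ⟨f, hf, hfm, hcont f⟩
      have hP : P ≤ P + Q := Measure.le_add_right le_rfl
      have hQ : Q ≤ P + Q := Measure.le_add_left le_rfl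
      have huP := hu.mono_measure hP
      have huQ := hu.mono_measure hQ
      have hmP := hmem.mono_measure hP
      have hmQ := hmem.mono_measure hQ
      have e1 : eLpNorm (u - u') 1 P ≤ ε :=
        (eLpNorm_le_eLpNorm_of_exponent_le hβ1 (huP.sub hmP).aestronglyMeasurable).trans
          ((eLpNorm_mono_measure _ hP).trans hu')
      have e2 : eLpNorm (u' - u) (ENNReal.ofReal β) Q ≤ ε := by
        rw [eLpNorm_sub_comm]
        exact (eLpNorm_mono_measure _ hQ).trans hu'
      calc eLpNorm u 1 P = eLpNorm ((u - u') + u') 1 P := by simp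
        _ ≤ eLpNorm (u - u') 1 P + eLpNorm u' 1 P :=
          eLpNorm_add_le (huP.sub hmP).aestronglyMeasurable hmP.aestronglyMeasurable le_rfl
        _ ≤ ε + C ^ (1 / α) * eLpNorm u' (ENNReal.ofReal β) Q := add_le_add e1 hbound
        _ = ε + C ^ (1 / α) * eLpNorm (u + (u' - u)) (ENNReal.ofReal β) Q := by simp
        _ ≤ ε + C ^ (1 / α) * (eLpNorm u (ENNReal.ofReal β) Q + ε) := by
          gcongr
          exact (eLpNorm_add_le huQ.aestronglyMeasurable
            (hmQ.sub huQ).aestronglyMeasurable hβ1).trans (by gcongr)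
    have hlim : Tendsto (fun ε : ℝ≥0∞ => ε + C ^ (1 / α) * (eLpNorm u (ENNReal.ofReal β) Q + ε))
        (𝓝[≠] 0) (𝓝 (0 + C ^ (1 / α) * (eLpNorm u (ENNReal.ofReal β) Q + 0))) := by
      refine Tendsto.mono_left ?_ nhdsWithin_le_nhds
      exact tendsto_id.add (ENNReal.Tendsto.const_mul (tendsto_const_nhds.add tendsto_id)
        (Or.inr hCtop))
    rw [zero_add, add_zero] at hlim
    exact ge_of_tendsto hlim (eventually_mem_nhdsWithin.mono fun ε hε => key ε hε)
  intro g hg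
  -- Truncation puts a general `g` into `L^β(P + Q)`; monotone convergence removes it.
  have hlim : Tendsto (fun m : ℕ => ∫⁻ x, min (g x) m ∂P) atTop (𝓝 (∫⁻ x, g x ∂P)) :=
    lintegral_tendsto_of_tendsto_of_monotone (fun m => by fun_prop)
      (ae_of_all _ fun x => monotone_min_natCast _) (ae_of_all _ fun x => tendsto_min_natCast _)
  refine le_of_tendsto' hlim fun m => ?_
  have hfin : ∀ x, min (g x) (m : ℝ≥0∞) ≠ ⊤ := fun x => by simp
  have henorm : ∀ x, ‖(min (g x) (m : ℝ≥0∞)).toReal‖ₑ = min (g x) m := fun x => by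
    rw [Real.enorm_of_nonneg ENNReal.toReal_nonneg, ENNReal.ofReal_toReal (hfin x)]
  have hb := hbdd (fun x => (min (g x) (m : ℝ≥0∞)).toReal) (by
    refine MemLp.of_bound
      (hg.min measurable_const).ennreal_toReal.aestronglyMeasurable m (ae_of_all _ fun x => ?_)
    rw [Real.norm_of_nonneg ENNReal.toReal_nonneg]
    exact ENNReal.toReal_le_of_le_ofReal (by positivity) (by simp))
  rw [hnorm, eLpNorm_one_eq_lintegral_enorm] at hb
  simp only [henorm] at hb
  refine hb.trans ?_
  have h1β : 0 ≤ 1 / β := by positivity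
  gcongr
  exact min_le_left _ _

/-- Lower semicontinuity of the Rényi moment under weak convergence. -/
theorem eventually_lt_renyiMoment [TopologicalSpace X] [BorelSpace X] [NormalSpace X]
    (hαβ : α.HolderConjugate β) {Pn Qn : ℕ → Measure X} {P Q : Measure X}
    [∀ n, IsFiniteMeasure (Pn n)] [∀ n, IsFiniteMeasure (Qn n)]
    [IsProbabilityMeasure P] [IsFiniteMeasure Q] [(P + Q).WeaklyRegular]
    (hP : ∀ g : X → NNReal, Continuous g → (∃ M, ∀ x, g x ≤ M) →
      Tendsto (fun n => ∫⁻ x, g x ∂(Pn n)) atTop (𝓝 (∫⁻ x, g x ∂P)))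
    (hQ : ∀ g : X → NNReal, Continuous g → (∃ M, ∀ x, g x ≤ M) →
      Tendsto (fun n => ∫⁻ x, g x ∂(Qn n)) atTop (𝓝 (∫⁻ x, g x ∂Q)))
    {C : ℝ≥0∞} (hC : C < renyiMoment α P Q) : ∀ᶠ n in atTop, C < renyiMoment α (Pn n) (Qn n) := by
  by_contra hcon
  rw [not_eventually] at hcon
  simp only [not_lt] at hcon
  -- If the moments were at most `C` for infinitely many `n`, the Hölder bound with `C` would pass
  -- to the weak limit along those `n`, contradicting `hC`.
  refine hC.not_ge (HolderBound.renyiMoment_le hαβ ?_)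
  refine HolderBound.of_continuous hC.ne_top hαβ fun g hg hM => ?_
  have hβ0 := hαβ.symm.pos
  have hα0 := hαβ.pos
  -- `g ^ β` is again bounded and continuous, so weak convergence handles the right-hand side too.
  have hg' := hQ (fun x => g x ^ β) ((NNReal.continuous_rpow_const hβ0.le).comp hg) <| by
    obtain ⟨M, hM⟩ := hM
    exact ⟨M ^ β, fun x => NNReal.rpow_le_rpow (hM x) hβ0.le⟩
  simp only [ENNReal.coe_rpow_of_nonneg _ hβ0.le] at hg'
  have hCtop : C ^ (1 / α) ≠ ⊤ := ENNReal.rpow_ne_top_of_nonneg (by positivity) hC.ne_top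
  have hlim := ENNReal.Tendsto.const_mul (a := C ^ (1 / α))
    (((ENNReal.continuous_rpow_const (y := 1 / β)).tendsto _).comp hg') (Or.inr hCtop)
  refine le_of_tendsto_of_tendsto_of_frequently (hP g hg hM) hlim (hcon.mono fun n hn => ?_)
  have hb := holderBound_renyiMoment hαβ (hn.trans_lt hC.lt_top).ne (fun x => (g x : ℝ≥0∞))
    (by have := hg.measurable; fun_prop)
  refine hb.trans ?_
  have h1α : 0 ≤ 1 / α := by positivity
  simp only [Function.comp_apply]
  gcongr

theorem tendsto_renyiDiv (hα : 1 < α) {P Q : Measure X} {Y : ℕ → Type*}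
    [∀ n, MeasurableSpace (Y n)] {Pn Qn : ∀ n, Measure (Y n)}
    (h : Tendsto (fun n => renyiMoment α (Pn n) (Qn n)) atTop (𝓝 (renyiMoment α P Q))) :
    Tendsto (fun n => renyiDiv α (Pn n) (Qn n)) atTop (𝓝 (renyiDiv α P Q)) := by
  simp only [renyiDiv_eq_log_renyiMoment hα]
  exact EReal.Tendsto.const_mul ((ENNReal.continuous_log.tendsto _).comp h)
    (Or.inl (EReal.coe_ne_bot _)) (Or.inl (EReal.coe_ne_top _))

end Renyi

/-! ### Gaussian rows and sampling synthetic data from the Gram matrix -/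

section Gaussian

variable {d e k n : ℕ}

instance (m n : ℕ) : BorelSpace (Matrix (Fin m) (Fin n) ℝ) :=
  inferInstanceAs (BorelSpace (Fin m → Fin n → ℝ))

instance (m n : ℕ) : SecondCountableTopology (Matrix (Fin m) (Fin n) ℝ) :=
  inferInstanceAs (SecondCountableTopology (Fin m → Fin n → ℝ))

instance (m n : ℕ) : TopologicalSpace.PseudoMetrizableSpace (Matrix (Fin m) (Fin n) ℝ) :=
  inferInstanceAs (TopologicalSpace.PseudoMetrizableSpace (Fin m → Fin n → ℝ))

instance (m n : ℕ) : NormalSpace (Matrix (Fin m) (Fin n) ℝ) :=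
  inferInstanceAs (NormalSpace (Fin m → Fin n → ℝ))

instance (m n : ℕ) : IsProbabilityMeasure (gaussianMatrix m n) :=
  inferInstanceAs (IsProbabilityMeasure
    (Measure.pi (fun _ : Fin m => Measure.pi (fun _ : Fin n => gaussianReal 0 1))))

instance (v : Matrix (Fin d) (Fin k) ℝ) : IsProbabilityMeasure (paramLaw v) :=
  Measure.isProbabilityMeasure_map (continuous_const.add continuous_id).measurable.aemeasurable

theorem measurable_gram : Measurable (fun V : Matrix (Fin d) (Fin k) ℝ => Vᵀ * V) :=
  Continuous.measurable (by fun_prop)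

theorem measurable_mul :
    Measurable (fun p : Matrix (Fin n) (Fin d) ℝ × Matrix (Fin d) (Fin k) ℝ => p.1 * p.2) :=
  Continuous.measurable (by fun_prop)

instance (v : Matrix (Fin d) (Fin k) ℝ) : IsProbabilityMeasure (gramLaw v) :=
  Measure.isProbabilityMeasure_map measurable_gram.aemeasurable

instance (n : ℕ) (v : Matrix (Fin d) (Fin k) ℝ) : IsProbabilityMeasure (synthLaw n v) :=
  Measure.isProbabilityMeasure_map measurable_mul.aemeasurable

theorem synthGramLaw_eq_map_synthLaw (n : ℕ) (v : Matrix (Fin d) (Fin k) ℝ) :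
    synthGramLaw n v = (synthLaw n v).map (fun Y => Yᵀ * Y) := by
  rw [synthLaw, Measure.map_map measurable_gram measurable_mul, synthGramLaw]
  congr 1
  ext1 p
  simp [Matrix.transpose_mul, Matrix.mul_assoc]

instance (n : ℕ) (v : Matrix (Fin d) (Fin k) ℝ) : IsProbabilityMeasure (synthGramLaw n v) := by
  rw [synthGramLaw_eq_map_synthLaw]
  exact Measure.isProbabilityMeasure_map measurable_gram.aemeasurable

/-- Shows that the quadratic form in the characteristic function of `z ᵥ* V` sees `V` only through
its Gram matrix. -/
theorem sum_sq_dual_row (V : Matrix (Fin d) (Fin k) ℝ) (L : StrongDual ℝ (Fin k → ℝ)) :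
    ∑ i, L (V i) ^ 2 =
      ∑ j, ∑ l, L (Pi.single j 1) * L (Pi.single l 1) * (Vᵀ * V) j l := by
  have hL : ∀ x : Fin k → ℝ, L x = ∑ j, x j * L (Pi.single j 1) := fun x => by
    conv_lhs => rw [pi_eq_sum_univ' x]
    simp [map_sum]
  simp only [Matrix.mul_apply, Matrix.transpose_apply, Finset.mul_sum]
  simp only [hL (V _), sq, Finset.sum_mul_sum]
  rw [Finset.sum_comm]
  refine Finset.sum_congr rfl fun j _ => ?_
  rw [Finset.sum_comm]
  refine Finset.sum_congr rfl fun l _ => Finset.sum_congr rfl fun i _ => ?_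
  ring

theorem charFunDual_pi_gaussianReal_map_vecMul (V : Matrix (Fin d) (Fin k) ℝ)
    (L : StrongDual ℝ (Fin k → ℝ)) :
    charFunDual ((Measure.pi fun _ : Fin d => gaussianReal 0 1).map (fun z => z ᵥ* V)) L =
      Complex.exp (-((∑ i, L (V i) ^ 2 : ℝ) : ℂ) / 2) := by
  have hL : ∀ z : Fin d → ℝ, L (z ᵥ* V) = ∑ i, z i * L (V i) := fun z => by
    simp [Matrix.vecMul_eq_sum, map_sum]
  -- `L (z ᵥ* V)` is the inner product of `z` with the vector `(L (V i))ᵢ`, so the standard Gaussian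
  -- characteristic function is evaluated there.
  have h1 := charFun_stdGaussian (E := EuclideanSpace ℝ (Fin d))
    (WithLp.toLp 2 fun i => L (V i))
  rw [← map_pi_eq_stdGaussian, charFun_apply, integral_map (by fun_prop) (by fun_prop)] at h1
  have hm : Measurable fun z : Fin d → ℝ => z ᵥ* V := Continuous.measurable (by fun_prop)
  rw [charFunDual_apply, integral_map hm.aemeasurable (by fun_prop)]
  simp only [hL]
  have h2 : ((‖WithLp.toLp 2 fun i => L (V i)‖ : ℝ) : ℂ) ^ 2 = ((∑ i, L (V i) ^ 2 : ℝ) : ℂ) := by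
    rw [← Complex.ofReal_pow, EuclideanSpace.norm_sq_eq]
    simp
  rw [h2] at h1
  rw [← h1]
  congr 1
  ext z
  simp [PiLp.inner_apply, mul_comm]

theorem pi_gaussianReal_map_vecMul_congr {V : Matrix (Fin d) (Fin k) ℝ}
    {W : Matrix (Fin e) (Fin k) ℝ} (h : Vᵀ * V = Wᵀ * W) :
    (Measure.pi fun _ : Fin d => gaussianReal 0 1).map (fun z => z ᵥ* V) =
      (Measure.pi fun _ : Fin e => gaussianReal 0 1).map (fun z => z ᵥ* W) := by
  have hV : Measurable fun z : Fin d → ℝ => z ᵥ* V := Continuous.measurable (by fun_prop)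
  have hW : Measurable fun z : Fin e → ℝ => z ᵥ* W := Continuous.measurable (by fun_prop)
  have := Measure.isProbabilityMeasure_map (μ := Measure.pi fun _ : Fin d => gaussianReal 0 1)
    hV.aemeasurable
  have := Measure.isProbabilityMeasure_map (μ := Measure.pi fun _ : Fin e => gaussianReal 0 1)
    hW.aemeasurable
  refine Measure.ext_of_charFunDual (funext fun L => ?_)
  rw [charFunDual_pi_gaussianReal_map_vecMul, charFunDual_pi_gaussianReal_map_vecMul,
    sum_sq_dual_row, sum_sq_dual_row, h]

/-- The law of `Z V` depends only on the Gram matrix of `V`. -/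
theorem gaussianMatrix_map_mul_congr (n : ℕ) {V : Matrix (Fin d) (Fin k) ℝ}
    {W : Matrix (Fin e) (Fin k) ℝ} (h : Vᵀ * V = Wᵀ * W) :
    (gaussianMatrix n d).map (· * V) = (gaussianMatrix n e).map (· * W) := by
  -- Right multiplication acts on each row separately, so the product structure survives and one row
  -- suffices.
  have key : ∀ {m : ℕ} (U : Matrix (Fin m) (Fin k) ℝ), (gaussianMatrix n m).map (· * U) =
      Measure.pi fun _ : Fin n =>
        (Measure.pi fun _ : Fin m => gaussianReal 0 1).map (fun z => z ᵥ* U) := by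
    intro m U
    have hU : Measurable fun z : Fin m → ℝ => z ᵥ* U := Continuous.measurable (by fun_prop)
    have := Measure.isProbabilityMeasure_map (μ := Measure.pi fun _ : Fin m => gaussianReal 0 1)
      hU.aemeasurable
    exact Measure.pi_map_pi (fun _ => hU.aemeasurable)
  rw [key, key, pi_gaussianReal_map_vecMul_congr h]

open scoped MatrixOrder in
theorem isClosed_matrix_nonneg : IsClosed {G : Matrix (Fin k) (Fin k) ℝ | 0 ≤ G} := by
  simp only [Matrix.nonneg_iff_posSemidef, Matrix.posSemidef_iff_dotProduct_mulVec,
    Matrix.IsHermitian, Set.ofPred_and, Set.ofPred_forall]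
  refine IsClosed.inter (isClosed_eq (by fun_prop) (by fun_prop)) (isClosed_iInter fun x => ?_)
  exact isClosed_le continuous_const (by fun_prop)

open scoped Matrix.Norms.L2Operator MatrixOrder in
/-- The square root of a positive semidefinite matrix, and `0` for all other matrices. -/
noncomputable def psdSqrt (G : Matrix (Fin k) (Fin k) ℝ) : Matrix (Fin k) (Fin k) ℝ := CFC.sqrt G

open scoped Matrix.Norms.L2Operator MatrixOrder in
-- The square root is continuous on the closed cone of positive semidefinite matrices and zero off
-- it.
theorem measurable_psdSqrt : Measurable (psdSqrt (k := k)) := by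
  classical
  have hcl := isClosed_matrix_nonneg (k := k)
  have hc : ContinuousOn (CFC.sqrt : Matrix (Fin k) (Fin k) ℝ → _) {G | 0 ≤ G} :=
    CFC.continuousOn_sqrt
  have h := hc.measurable_piecewise (g := fun _ => 0) continuousOn_const hcl.measurableSet
  convert h using 1
  ext1 G
  by_cases hG : 0 ≤ G
  · simp [psdSqrt, hG]
  · simp [psdSqrt, hG, CFC.sqrt_of_not_nonneg]

open scoped Matrix.Norms.L2Operator MatrixOrder in
theorem gram_psdSqrt_gram (V : Matrix (Fin d) (Fin k) ℝ) :
    (psdSqrt (Vᵀ * V))ᵀ * psdSqrt (Vᵀ * V) = Vᵀ * V := by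
  have h0 : 0 ≤ Vᵀ * V := by
    rw [Matrix.nonneg_iff_posSemidef]
    simpa using Matrix.posSemidef_conjTranspose_mul_self V
  have h1 : (CFC.sqrt (Vᵀ * V))ᵀ = CFC.sqrt (Vᵀ * V) := by
    have := (IsSelfAdjoint.of_nonneg (CFC.sqrt_nonneg (Vᵀ * V))).star_eq
    simpa [Matrix.star_eq_conjTranspose] using this
  rw [psdSqrt, h1, CFC.sqrt_mul_sqrt_self _ h0]

/-- The synthetic data set is a randomized function of the Gram matrix. -/
theorem synthLaw_eq_map_gramLaw (n : ℕ) (v : Matrix (Fin d) (Fin k) ℝ) :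
    synthLaw n v =
      ((gaussianMatrix n k).prod (gramLaw v)).map (fun p => p.1 * psdSqrt p.2) := by
  have hS : Measurable (fun p : Matrix (Fin n) (Fin k) ℝ × Matrix (Fin k) (Fin k) ℝ =>
      p.1 * psdSqrt p.2) :=
    measurable_mul.comp (measurable_fst.prodMk (measurable_psdSqrt.comp measurable_snd))
  refine Measure.ext_of_lintegral _ fun g hg => ?_
  have hf1 := hg.comp (measurable_mul (n := n) (d := d) (k := k))
  have hf2 := hg.comp hS
  rw [synthLaw, lintegral_map hg measurable_mul, lintegral_map hg hS]
  -- Tonelli with the Gaussian factor innermost: for fixed `V`, the matrices `V` and `psdSqrt (Vᵀ *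
  -- V)` have the same Gram matrix.
  refine (lintegral_prod_symm _ hf1.aemeasurable).trans
    (Eq.trans ?_ (lintegral_prod_symm _ hf2.aemeasurable).symm)
  rw [gramLaw, lintegral_map (Measurable.lintegral_prod_left' hf2) measurable_gram]
  refine lintegral_congr fun V => ?_
  have hmul : ∀ {m : ℕ} (U : Matrix (Fin m) (Fin k) ℝ),
      Measurable fun Z : Matrix (Fin n) (Fin m) ℝ => Z * U :=
    fun U => Continuous.measurable (by fun_prop)
  have h := gaussianMatrix_map_mul_congr n (gram_psdSqrt_gram V).symm
  simp only [Function.comp_apply]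
  rw [← lintegral_map hg (hmul V), h, lintegral_map hg (hmul _)]

end Gaussian

/-! ### Law of large numbers and passage to the limit -/

section Limit

variable {d k n : ℕ}

theorem memLp_eval_pi_gaussianReal (i : Fin d) :
    MemLp (fun z : Fin d → ℝ => z i) 2 (Measure.pi fun _ : Fin d => gaussianReal 0 1) :=
  (memLp_id_gaussianReal 2).comp_measurePreserving
    (measurePreserving_eval (fun _ : Fin d => gaussianReal 0 1) i)

theorem integrable_eval_mul_eval (i j : Fin d) :
    Integrable (fun z : Fin d → ℝ => z i * z j) (Measure.pi fun _ : Fin d => gaussianReal 0 1) :=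
  (memLp_eval_pi_gaussianReal i).integrable_mul (memLp_eval_pi_gaussianReal j)

theorem integral_eval_mul_eval (i j : Fin d) :
    ∫ z, z i * z j ∂(Measure.pi fun _ : Fin d => gaussianReal 0 1) =
      (1 : Matrix (Fin d) (Fin d) ℝ) i j := by
  have hmean : ∀ i : Fin d, ∫ z, z i ∂(Measure.pi fun _ : Fin d => gaussianReal 0 1) = 0 :=
    fun i => by
      rw [integral_comp_eval (μ := fun _ : Fin d => gaussianReal 0 1) (i := i) (f := fun x : ℝ => x)
        (by fun_prop)]
      exact integral_id_gaussianReal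
  rcases eq_or_ne i j with rfl | hij
  · rw [Matrix.one_apply_eq, integral_comp_eval (μ := fun _ : Fin d => gaussianReal 0 1) (i := i)
      (f := fun x : ℝ => x * x) (by fun_prop)]
    have h := variance_eq_integral (μ := gaussianReal 0 1) (X := id) aemeasurable_id
    simpa [sq, variance_id_gaussianReal] using h.symm
  · rw [Matrix.one_apply_ne hij]
    have hind := (iIndepFun_pi (μ := fun _ : Fin d => gaussianReal 0 1) (X := fun _ x => x)
      (fun _ => aemeasurable_id)).indepFun hij
    refine (hind.integral_fun_mul_eq_mul_integral
      (measurable_pi_apply i).aestronglyMeasurable (measurable_pi_apply j).aestronglyMeasurable).trans ?_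
    rw [hmean, zero_mul]

/-- The law of an infinite sequence of independent standard Gaussian rows. -/
noncomputable def gaussianRows (d : ℕ) : Measure (ℕ → Fin d → ℝ) :=
  Measure.infinitePi fun _ : ℕ => Measure.pi fun _ : Fin d => gaussianReal 0 1

instance (d : ℕ) : IsProbabilityMeasure (gaussianRows d) :=
  inferInstanceAs (IsProbabilityMeasure (Measure.infinitePi _))

/-- The matrix formed by the first `n` rows. -/
def firstRows (n : ℕ) (ω : ℕ → Fin d → ℝ) : Matrix (Fin n) (Fin d) ℝ := Matrix.of fun i => ω i

theorem measurable_firstRows : Measurable (firstRows (d := d) n) :=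
  measurable_pi_lambda _ fun i => measurable_pi_apply (i : ℕ)

/-- Realizes the Gaussian matrices of all sizes on one probability space, where almost sure
convergence makes sense. -/
theorem map_firstRows : (gaussianRows d).map (firstRows n) = gaussianMatrix n d := by
  have h := (iIndepFun_infinitePi (P := fun _ : ℕ => Measure.pi fun _ : Fin d => gaussianReal 0 1)
    (X := fun _ x => x) (fun _ => measurable_id)).precomp (Fin.val_injective (n := n))
  have h2 := (iIndepFun_iff_map_fun_eq_pi_map (fun i : Fin n =>
    (measurable_pi_apply (i : ℕ)).aemeasurable)).1 h
  refine h2.trans ?_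
  rw [gaussianMatrix]
  congr 1
  ext1 i
  exact Measure.infinitePi_map_eval _ _

/-- Each entry is an average of i.i.d. products `z i * z j` with mean `δ i j`; the strong law is
applied to the finitely many entries. -/
theorem ae_tendsto_firstRows_gram : ∀ᵐ ω ∂(gaussianRows d),
    Tendsto (fun n : ℕ => (n : ℝ)⁻¹ • ((firstRows n ω)ᵀ * firstRows n ω)) atTop (𝓝 1) := by
  have h : ∀ i j : Fin d, ∀ᵐ ω ∂(gaussianRows d),
      Tendsto (fun n : ℕ => (∑ r ∈ Finset.range n, ω r i * ω r j) / (n : ℝ)) atTop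
        (𝓝 ((1 : Matrix (Fin d) (Fin d) ℝ) i j)) := by
    intro i j
    have hm : Measurable fun z : Fin d → ℝ => z i * z j := by fun_prop
    have hev : ∀ r : ℕ, MeasurePreserving (fun ω : ℕ → Fin d → ℝ => ω r) (gaussianRows d)
        (Measure.pi fun _ : Fin d => gaussianReal 0 1) :=
      fun r => ⟨by fun_prop, Measure.infinitePi_map_eval _ _⟩
    have hind := iIndepFun_infinitePi
      (P := fun _ : ℕ => Measure.pi fun _ : Fin d => gaussianReal 0 1)
      (X := fun _ z => z i * z j) (fun _ => hm)
    have hl := strong_law_ae_real (μ := gaussianRows d) (fun r ω => ω r i * ω r j)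
      ((hev 0).integrable_comp_of_integrable (integrable_eval_mul_eval i j))
      (fun r s hrs => hind.indepFun hrs) (fun r => by
        have hid : IdentDistrib (fun ω : ℕ → Fin d → ℝ => ω r) (fun ω => ω 0) (gaussianRows d)
            (gaussianRows d) :=
          ⟨(hev r).aemeasurable, (hev 0).aemeasurable, (hev r).map_eq.trans (hev 0).map_eq.symm⟩
        exact hid.comp hm)
    have hint : ∫ ω, ω 0 i * ω 0 j ∂(gaussianRows d) = (1 : Matrix (Fin d) (Fin d) ℝ) i j := by
      rw [← integral_eval_mul_eval, ← (hev 0).map_eq,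
        integral_map (hev 0).aemeasurable hm.aestronglyMeasurable]
    rwa [hint] at hl
  filter_upwards [ae_all_iff.2 fun i => ae_all_iff.2 (h i)] with ω hω
  refine tendsto_pi_nhds.2 fun i => tendsto_pi_nhds.2 fun j => (hω i j).congr fun n => ?_
  rw [Finset.sum_range, div_eq_inv_mul]
  rfl

theorem measurable_transpose_mul_firstRows_gram_mul (n : ℕ) :
    Measurable fun p : (ℕ → Fin d → ℝ) × Matrix (Fin d) (Fin k) ℝ =>
      p.2ᵀ * ((firstRows n p.1)ᵀ * firstRows n p.1) * p.2 := by
  have h : Measurable fun p : Matrix (Fin n) (Fin d) ℝ × Matrix (Fin d) (Fin k) ℝ =>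
      p.2ᵀ * (p.1ᵀ * p.1) * p.2 := Continuous.measurable (by fun_prop)
  have hr : Measurable fun p : (ℕ → Fin d → ℝ) × Matrix (Fin d) (Fin k) ℝ =>
      (firstRows n p.1, p.2) := (measurable_firstRows.comp measurable_fst).prodMk measurable_snd
  have h3 := h.comp hr
  rw [Function.comp_def] at h3
  exact h3

theorem synthGramLaw_eq_map_gaussianRows (n : ℕ) (v : Matrix (Fin d) (Fin k) ℝ) :
    synthGramLaw n v = ((gaussianRows d).prod (paramLaw v)).map
      (fun p => p.2ᵀ * ((firstRows n p.1)ᵀ * firstRows n p.1) * p.2) := by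
  have hg : Measurable fun p : Matrix (Fin n) (Fin d) ℝ × Matrix (Fin d) (Fin k) ℝ =>
      p.2ᵀ * p.1ᵀ * p.1 * p.2 := Continuous.measurable (by fun_prop)
  have hp := Measure.map_prod_map (gaussianRows d) (paramLaw v) (measurable_firstRows (n := n))
    measurable_id
  rw [Measure.map_id, map_firstRows] at hp
  rw [synthGramLaw, hp, Measure.map_map hg (measurable_firstRows.prodMap measurable_id)]
  congr 1
  ext1 p
  simp [Matrix.mul_assoc]

theorem lintegral_synthGramLaw (n : ℕ) (v : Matrix (Fin d) (Fin k) ℝ)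
    {g : Matrix (Fin k) (Fin k) ℝ → ℝ≥0∞} (hg : Measurable g) :
    ∫⁻ x, g x ∂(synthGramLaw n v) =
      ∫⁻ p, g (p.2ᵀ * ((firstRows n p.1)ᵀ * firstRows n p.1) * p.2)
        ∂((gaussianRows d).prod (paramLaw v)) := by
  rw [synthGramLaw_eq_map_gaussianRows,
    lintegral_map hg (measurable_transpose_mul_firstRows_gram_mul n)]

theorem lintegral_gramLaw (v : Matrix (Fin d) (Fin k) ℝ) {g : Matrix (Fin k) (Fin k) ℝ → ℝ≥0∞}
    (hg : Measurable g) :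
    ∫⁻ x, g x ∂(gramLaw v) = ∫⁻ p, g (p.2ᵀ * p.2) ∂((gaussianRows d).prod (paramLaw v)) := by
  have hsnd := measurePreserving_snd (μ := gaussianRows d) (ν := paramLaw v)
  rw [gramLaw, lintegral_map hg measurable_gram]
  exact (hsnd.lintegral_comp (hg.comp measurable_gram)).symm

/-- The rescaled synthetic Gram matrix converges weakly to the Gram matrix. -/
theorem tendsto_lintegral_synthGramLaw (v : Matrix (Fin d) (Fin k) ℝ)
    (g : Matrix (Fin k) (Fin k) ℝ → NNReal) (hg : Continuous g) (hM : ∃ M, ∀ x, g x ≤ M) :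
    Tendsto (fun n : ℕ => ∫⁻ x, g x ∂((synthGramLaw n v).map fun G => (n : ℝ)⁻¹ • G)) atTop
      (𝓝 (∫⁻ x, g x ∂(gramLaw v))) := by
  obtain ⟨M, hM⟩ := hM
  have hgm : Measurable fun x => (g x : ℝ≥0∞) := hg.measurable.coe_nnreal_ennreal
  have hsm : ∀ c : ℝ, Measurable fun G : Matrix (Fin k) (Fin k) ℝ => c • G :=
    fun c => Continuous.measurable (by fun_prop)
  have hgs : ∀ c : ℝ, Measurable fun G => (g (c • G) : ℝ≥0∞) := fun c => hgm.comp (hsm c)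
  have hL : ∀ n : ℕ, ∫⁻ x, g x ∂((synthGramLaw n v).map fun G => (n : ℝ)⁻¹ • G) =
      ∫⁻ p, g ((n : ℝ)⁻¹ • (p.2ᵀ * ((firstRows n p.1)ᵀ * firstRows n p.1) * p.2))
        ∂((gaussianRows d).prod (paramLaw v)) := fun n => by
    rw [lintegral_map hgm (hsm _), lintegral_synthGramLaw n v (hgs _)]
  simp only [hL, lintegral_gramLaw v hgm]
  refine tendsto_lintegral_of_dominated_convergence (fun _ => (M : ℝ≥0∞))
    (fun n => (hgs (n : ℝ)⁻¹).comp (measurable_transpose_mul_firstRows_gram_mul n))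
    (fun n => ae_of_all _ fun p => ENNReal.coe_le_coe.2 (hM _)) (by simp) ?_
  -- For fixed `V`, the integrand depends continuously on `ZᵀZ / n`, which tends to `1` almost
  -- surely.
  have hae := (Measure.quasiMeasurePreserving_fst (μ := gaussianRows d) (ν := paramLaw v)).ae
    (ae_tendsto_firstRows_gram (d := d))
  filter_upwards [hae] with p hp
  have hc : Continuous fun G : Matrix (Fin d) (Fin d) ℝ => (g (p.2ᵀ * G * p.2) : ℝ≥0∞) :=
    ENNReal.continuous_coe.comp (hg.comp (by fun_prop))
  have h := (hc.tendsto 1).comp hp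
  simpa only [Function.comp_def, Matrix.mul_smul, Matrix.smul_mul, Matrix.mul_one] using h

theorem renyiMoment_synthLaw_le {α β : ℝ} (hαβ : α.HolderConjugate β) (n : ℕ)
    (v w : Matrix (Fin d) (Fin k) ℝ) :
    renyiMoment α (synthLaw n v) (synthLaw n w) ≤ renyiMoment α (gramLaw v) (gramLaw w) := by
  rw [synthLaw_eq_map_gramLaw, synthLaw_eq_map_gramLaw]
  exact (renyiMoment_map_le hαβ (measurable_mul.comp
    (measurable_fst.prodMk (measurable_psdSqrt.comp measurable_snd)))).trans
    (renyiMoment_prod_left_le hαβ _)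

theorem renyiMoment_synthGramLaw_le {α β : ℝ} (hαβ : α.HolderConjugate β) (n : ℕ)
    (v w : Matrix (Fin d) (Fin k) ℝ) :
    renyiMoment α (synthGramLaw n v) (synthGramLaw n w) ≤
      renyiMoment α (synthLaw n v) (synthLaw n w) := by
  rw [synthGramLaw_eq_map_synthLaw, synthGramLaw_eq_map_synthLaw]
  exact renyiMoment_map_le hαβ measurable_gram

theorem tendsto_renyiMoment_synthGramLaw {α β : ℝ} (hαβ : α.HolderConjugate β)
    (v w : Matrix (Fin d) (Fin k) ℝ) :
    Tendsto (fun n : ℕ => renyiMoment α (synthGramLaw n v) (synthGramLaw n w)) atTop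
      (𝓝 (renyiMoment α (gramLaw v) (gramLaw w))) := by
  have hsm : ∀ c : ℝ, Measurable fun G : Matrix (Fin k) (Fin k) ℝ => c • G :=
    fun c => Continuous.measurable (by fun_prop)
  refine tendsto_order.2 ⟨fun C hC => ?_, fun C hC => Eventually.of_forall fun n =>
    ((renyiMoment_synthGramLaw_le hαβ n v w).trans
      (renyiMoment_synthLaw_le hαβ n v w)).trans_lt hC⟩
  filter_upwards [eventually_lt_renyiMoment hαβ (tendsto_lintegral_synthGramLaw v)
    (tendsto_lintegral_synthGramLaw w) hC] with n hn
  -- Undoing the scaling by `1 / n` needs only data processing, not invertibility, so `n = 0` is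
  -- harmless.
  exact hn.trans_le (renyiMoment_map_le hαβ (hsm _))

end Limit

end GramRelease

theorem mainTheorem4 (d k : ℕ) (hdk : k ≤ d) (α : ℝ) (hα : 1 < α)
    (v w : Matrix (Fin d) (Fin k) ℝ) :
    Tendsto (fun n : ℕ => GramRelease.renyiDiv α
        (GramRelease.synthGramLaw n v) (GramRelease.synthGramLaw n w)) atTop
      (𝓝 (GramRelease.renyiDiv α (GramRelease.gramLaw v) (GramRelease.gramLaw w))) ∧
    (∀ n : ℕ, GramRelease.renyiDiv α (GramRelease.synthLaw n v) (GramRelease.synthLaw n w) ≤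
      GramRelease.renyiDiv α (GramRelease.gramLaw v) (GramRelease.gramLaw w)) ∧
    Tendsto (fun n : ℕ => GramRelease.renyiDiv α
        (GramRelease.synthLaw n v) (GramRelease.synthLaw n w)) atTop
      (𝓝 (GramRelease.renyiDiv α (GramRelease.gramLaw v) (GramRelease.gramLaw w))) := by
  have hαβ := Real.HolderConjugate.conjExponent hα
  have hlim := GramRelease.tendsto_renyiMoment_synthGramLaw hαβ v w
  refine ⟨GramRelease.tendsto_renyiDiv hα hlim, fun n => ?_,
    -- The moment of `ZV` is squeezed between those of `VᵀZᵀZV` and `VᵀV`.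
    GramRelease.tendsto_renyiDiv hα (tendsto_of_tendsto_of_tendsto_of_le_of_le hlim
      tendsto_const_nhds (fun n => GramRelease.renyiMoment_synthGramLaw_le hαβ n v w)
      fun n => GramRelease.renyiMoment_synthLaw_le hαβ n v w)⟩
  rw [GramRelease.renyiDiv_eq_log_renyiMoment hα, GramRelease.renyiDiv_eq_log_renyiMoment hα]
  exact mul_le_mul_of_nonneg_left
    (ENNReal.log_monotone (GramRelease.renyiMoment_synthLaw_le hαβ n v w))
    (by exact_mod_cast (inv_pos.2 (sub_pos.2 hα)).le)
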